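/- Conventions. A profile curve is a smooth regular curve $\gamma(t)=(\rho(t),h(t))$, $t\in\mathbb R$, in a plane containing the axis of revolution ($\rho$ is the signed distance to the axis). Rotating it about the axis gives a surface of revolution $M_\gamma$, in one of two ways. (i) \emph{With a vertex}: $\rho$ is odd and $h$ is even, and $M_\gamma$ is parametrized by $\mathbb R^2$, the point with polar coordinates $(t,\varphi)$ going to $(\rho(t)\cos\varphi,\rho(t)\sin\varphi,h(t))$. (ii) \emph{Without a vertex}: $M_\gamma$ is parametrized by $\mathbb R\times S^1$ by the same formula. The surface is complete if both ends of $\gamma$ have infinite length, and embedded if the parametrization is a smooth embedding. (A complete embedded surface of this kind is non-compact; compact surfaces such as small spheres are not considered.) Let $s(t)$ be the arclength of $\gamma$ from $t=0$ to $t$; a point of $M_\gamma$ with meridian parameter $t$ is said to lie at distance $|s(t)|$ from the vertex, respectively from the base parallel $t=0$. The Gauss curvature $K_M$ of a surface of revolution $M$ \emph{exceeds} the Gauss curvature $K_P$ of a paraboloid $P$ if $K_M(p)\ge K_P(q)$ whenever $p\in M$ and $q\in P$ lie at the same distance from their respective vertices (or base parallel), with strict inequality for some such pair; only points at which the parametrization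 is regular are compared. Theorem. Among the complete embedded non-compact surfaces of revolution in $\mathbb R^3$, the paraboloid is most curved. That is, let $k>0$ and let $P$ be the paraboloid $z=k(x^2+y^2)$. Then $P$ is a complete embedded surface of revolution with a vertex, and if $M$ is a complete surface of revolution (with or without a vertex) whose Gauss curvature exceeds that of $P$, then $M$ is not embedded. -/

import Mathlib

open scoped ContDiff Manifold

noncomputable section

namespace RevolutionSurface

/-- The Euclidean plane. -/
abbrev E2 := EuclideanSpace ℝ (Fin 2)

/-- Euclidean three-space. -/
abbrev E3 := EuclideanSpace ℝ (Fin 3)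

/-! ### Gaussian curvature of a parametrized surface -/

/-- The partial derivative of `X` with respect to the `i`-th coordinate. -/
def pd (i : Fin 2) (X : E2 → E3) (u : E2) : E3 :=
  lineDeriv ℝ X u (EuclideanSpace.single i 1)

/-- The normal vector `∂₁X × ∂₂X`. -/
def normalVec (X : E2 → E3) (u : E2) : E3 :=
  WithLp.toLp 2 (crossProduct (pd 0 X u).ofLp (pd 1 X u).ofLp)

/-- `X` is regular at `u`: the tangent vectors `∂₁X`, `∂₂X` are linearly independent. -/
def IsRegularAt (X : E2 → E3) (u : E2) : Prop :=
  LinearIndependent ℝ ![pd 0 X u, pd 1 X u]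

/-- The unit normal. -/
def unitNormal (X : E2 → E3) (u : E2) : E3 :=
  ‖normalVec X u‖⁻¹ • normalVec X u

/-- The first fundamental form `⟨∂ᵢX, ∂ⱼX⟩`. -/
def firstForm (X : E2 → E3) (u : E2) : Matrix (Fin 2) (Fin 2) ℝ :=
  Matrix.of fun i j => inner ℝ (pd i X u) (pd j X u)

/-- The second fundamental form `⟨∂ᵢ∂ⱼX, N⟩`. -/
def secondForm (X : E2 → E3) (u : E2) : Matrix (Fin 2) (Fin 2) ℝ :=
  Matrix.of fun i j => inner ℝ (pd i (pd j X) u) (unitNormal X u)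

/-- The Gaussian curvature `det II / det I`, meaningful at regular points. -/
def gaussCurvature (X : E2 → E3) (u : E2) : ℝ :=
  (secondForm X u).det / (firstForm X u).det

/-! ### Profile curves and the surfaces they generate -/

/-- A smooth regular curve `t ↦ (radius t, height t)` in the plane that contains the axis of
revolution; `radius` is the signed distance to the axis. -/
structure ProfileCurve where
  radius : ℝ → ℝ
  height : ℝ → ℝ
  smooth_radius : ContDiff ℝ ∞ radius
  smooth_height : ContDiff ℝ ∞ height
  regular : ∀ t, deriv radius t ≠ 0 ∨ deriv height t ≠ 0

namespace ProfileCurve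

/-- The speed of the curve. -/
def speed (γ : ProfileCurve) (t : ℝ) : ℝ :=
  Real.sqrt (deriv γ.radius t ^ 2 + deriv γ.height t ^ 2)

/-- Signed arclength measured from the base point `t = 0`. -/
def arcLength (γ : ProfileCurve) (t : ℝ) : ℝ := ∫ τ in (0 : ℝ)..t, γ.speed τ

/-- Completeness: both ends of the profile curve have infinite length. -/
def IsComplete (γ : ProfileCurve) : Prop :=
  Filter.Tendsto γ.arcLength Filter.atTop Filter.atTop ∧
    Filter.Tendsto γ.arcLength Filter.atBot Filter.atBot

/-- The profile curve is a full meridian through a vertex (`t = 0`) on the axis: it is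
symmetric under the reflection in the axis. -/
def HasVertex (γ : ProfileCurve) : Prop :=
  (∀ t, γ.radius (-t) = -γ.radius t) ∧ ∀ t, γ.height (-t) = γ.height t

/-- The surface of revolution with a vertex, as a map of the plane into space: in polar
coordinates, `(t, φ)` goes to `(radius t * cos φ, radius t * sin φ, height t)`. -/
def planeMap (γ : ProfileCurve) (v : E2) : E3 :=
  !₂[γ.radius ‖v‖ * (v 0 / ‖v‖), γ.radius ‖v‖ * (v 1 / ‖v‖), γ.height ‖v‖]

/-- Arclength along the meridian from the vertex to the point with parameter `v`. -/
def vertexDist (γ : ProfileCurve) (v : E2) : ℝ := γ.arcLength ‖v‖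

/-- The surface of revolution without vertex, as a map of the cylinder `ℝ × S¹` into space. -/
def tubeMap (γ : ProfileCurve) (p : ℝ × Circle) : E3 :=
  !₂[γ.radius p.1 * (p.2 : ℂ).re, γ.radius p.1 * (p.2 : ℂ).im, γ.height p.1]

/-- The same surface in the local coordinates `(t, φ)`, with `φ` the angle of rotation. -/
def tubeChart (γ : ProfileCurve) (u : E2) : E3 :=
  !₂[γ.radius (u 0) * Real.cos (u 1), γ.radius (u 0) * Real.sin (u 1), γ.height (u 0)]

/-- Arclength along the meridian from the parallel `t = 0` to the point with coordinates `u`. -/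
def tubeDist (γ : ProfileCurve) (u : E2) : ℝ := |γ.arcLength (u 0)|

/-- The surface with a vertex is smoothly embedded. -/
def IsEmbeddedPlane (γ : ProfileCurve) : Prop :=
  Manifold.IsSmoothEmbedding 𝓘(ℝ, E2) 𝓘(ℝ, E3) ∞ γ.planeMap

/-- The surface without vertex is smoothly embedded. -/
def IsEmbeddedTube (γ : ProfileCurve) : Prop :=
  Manifold.IsSmoothEmbedding (𝓘(ℝ, ℝ).prod (𝓡 1)) 𝓘(ℝ, E3) ∞ γ.tubeMap

/-- The parabola `z = k x²`, profile curve of the paraboloid `z = k (x² + y²)`. -/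
def parabola (k : ℝ) : ProfileCurve where
  radius t := t
  height t := k * t ^ 2
  smooth_radius := contDiff_id
  smooth_height := by fun_prop
  regular t := Or.inl (by simp)

end ProfileCurve

/-- The Gaussian curvature of the surface `X` exceeds that of `Y`, where `d` and `e` are the
distances from a base point (or base parallel): at all points at equal distance the curvature
of `X` is at least that of `Y`, and at some points at equal distance it is larger.
Only points where the surfaces are immersed are compared. -/
def CurvatureExceeds (X : E2 → E3) (d : E2 → ℝ) (Y : E2 → E3) (e : E2 → ℝ) : Prop :=
  (∀ u v, IsRegularAt X u → IsRegularAt Y v → d u = e v →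
    gaussCurvature Y v ≤ gaussCurvature X u) ∧
  ∃ u v, IsRegularAt X u ∧ IsRegularAt Y v ∧ d u = e v ∧
    gaussCurvature Y v < gaussCurvature X u

end RevolutionSurface

end

/-! Along a meridian with arclength s, the radius r satisfies the Jacobi equation r'' = -K r.
Embeddedness forces r to have no zero except at a vertex, since a parallel of radius zero collapses
to a point. The theorem thus becomes a statement about zeros of solutions of a second order linear
equation.

With a vertex, let Q be the radius of the parabola at the same arclength, so that Q'' = -K_P Q.
After a change of sign r > 0, and the Wronskian w = r'Q - rQ' vanishes at 0 with w' = (K_P - K) r Q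
≤ 0. Strict inequality somewhere makes w ≤ -c < 0 from some point on, hence (r/Q)' = w/Q² ≤ -c/Q².
On the parabola 2kQQ' ≤ 1, so 1/Q² ≥ 2k Q'/Q and ∫ ds/Q² dominates 2k log Q, which diverges. Then
r/Q becomes negative, a contradiction (`exists_radius_eq_zero`). The divergence of this integral is
what makes the paraboloid extremal.

Without a vertex, K ≥ K_P > 0 would make r a positive strictly concave function of s on the whole
line, and there is none (`exists_meridianCurvature_nonpos`).

The remaining work links the curvature of the parametrized surfaces to the profile formula
`meridianCurvature`. -/

noncomputable section

namespace RevolutionSurface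

open Filter Topology

/-! ### The paraboloid as an embedded graph -/

namespace ProfileCurve

/-- The paraboloid is the graph of `k (x² + y²)`. -/
theorem planeMap_parabola (k : ℝ) (v : E2) :
    (parabola k).planeMap v = !₂[v 0, v 1, k * (v 0 ^ 2 + v 1 ^ 2)] := by
  have h : ‖v‖ ^ 2 = v 0 ^ 2 + v 1 ^ 2 := by
    rw [EuclideanSpace.real_norm_sq_eq, Fin.sum_univ_two]
  have h' : ∀ i, ‖v‖ * (v i / ‖v‖) = v i := by
    intro i
    by_cases hv : v = 0
    · simp [hv]
    · have : ‖v‖ ≠ 0 := norm_ne_zero_iff.2 hv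
      field_simp
  simp only [planeMap, parabola, h', h]

/-- The shear of space that flattens the paraboloid `z = k (x² + y²)`. -/
def paraboloidShear (k : ℝ) : E3 ≃ₜ E3 where
  toFun w := !₂[w 0, w 1, w 2 - k * (w 0 ^ 2 + w 1 ^ 2)]
  invFun w := !₂[w 0, w 1, w 2 + k * (w 0 ^ 2 + w 1 ^ 2)]
  left_inv w := by ext i; fin_cases i <;> simp
  right_inv w := by ext i; fin_cases i <;> simp
  continuous_toFun := by
    refine (PiLp.continuous_toLp 2 _).comp (continuous_pi fun i => ?_)
    fin_cases i <;> simp <;> fun_prop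
  continuous_invFun := by
    refine (PiLp.continuous_toLp 2 _).comp (continuous_pi fun i => ?_)
    fin_cases i <;> simp <;> fun_prop

/-- The splitting of space into a horizontal plane and a vertical line. -/
def horizontalVertical : (E2 × ℝ) ≃L[ℝ] E3 :=
  LinearEquiv.toContinuousLinearEquiv
    { toFun := fun p => !₂[p.1 0, p.1 1, p.2]
      invFun := fun w => (!₂[w 0, w 1], w 2)
      left_inv := fun p => by
        ext i
        · fin_cases i <;> simp
        · simp
      right_inv := fun w => by ext i; fin_cases i <;> simp
      map_add' := fun p q => by ext i; fin_cases i <;> simp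
      map_smul' := fun c p => by ext i; fin_cases i <;> simp }

theorem contDiff_paraboloidShear (k : ℝ) : ContDiff ℝ ∞ (paraboloidShear k) := by
  rw [contDiff_euclidean]
  intro i
  fin_cases i <;> simp [paraboloidShear] <;> fun_prop

theorem contDiff_paraboloidShear_symm (k : ℝ) : ContDiff ℝ ∞ (paraboloidShear k).symm := by
  rw [contDiff_euclidean]
  intro i
  fin_cases i <;> simp [paraboloidShear] <;> fun_prop

theorem paraboloidShear_mem_maximalAtlas (k : ℝ) :
    (paraboloidShear k).toOpenPartialHomeomorph ∈ IsManifold.maximalAtlas 𝓘(ℝ, E3) ∞ E3 := by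
  refine StructureGroupoid.mem_maximalAtlas_of_mem_groupoid _ ?_
  rw [contDiffGroupoid, mem_groupoid_of_pregroupoid]
  constructor
  · simpa [contDiffPregroupoid, contDiffOn_univ] using contDiff_paraboloidShear k
  · simpa [contDiffPregroupoid, contDiffOn_univ] using contDiff_paraboloidShear_symm k

theorem continuous_planeMap_parabola (k : ℝ) : Continuous (parabola k).planeMap := by
  rw [funext (planeMap_parabola k)]
  refine (PiLp.continuous_toLp 2 _).comp (continuous_pi fun i => ?_)
  fin_cases i <;> simp <;> fun_prop

/-- Taking the shear as a chart of space turns the paraboloid into a flat plane, so the map reads v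
↦ (v, 0) with complement ℝ. Projection to the horizontal plane is a continuous left inverse, which
gives the topological embedding. -/
theorem isEmbeddedPlane_parabola (k : ℝ) : (parabola k).IsEmbeddedPlane := by
  refine ⟨Manifold.IsImmersionOfComplement.isImmersion (F := ℝ) fun x => ?_, ?_⟩
  · refine Manifold.IsImmersionAtOfComplement.mk_of_charts horizontalVertical
      (OpenPartialHomeomorph.refl E2) (paraboloidShear k).toOpenPartialHomeomorph
      (by simp) (by simp) (StructureGroupoid.id_mem_maximalAtlas _)
      (paraboloidShear_mem_maximalAtlas k) (by simp) ?_
    intro y _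
    ext i
    fin_cases i <;> simp [planeMap_parabola, paraboloidShear, horizontalVertical]
  · refine Function.LeftInverse.isEmbedding (f := fun w : E3 => (!₂[w 0, w 1] : E2)) ?_ ?_
      (continuous_planeMap_parabola k)
    · intro v
      ext i
      fin_cases i <;> simp [planeMap_parabola]
    · refine (PiLp.continuous_toLp 2 _).comp (continuous_pi fun i => ?_)
      fin_cases i <;> simp <;> fun_prop

theorem hasVertex_parabola (k : ℝ) : (parabola k).HasVertex :=
  ⟨fun _ => rfl, fun t => by simp [parabola]⟩

/-! ### Arclength -/

theorem continuous_speed (γ : ProfileCurve) : Continuous γ.speed := by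
  have h1 := γ.smooth_radius.continuous_deriv (by simp)
  have h2 := γ.smooth_height.continuous_deriv (by simp)
  unfold speed
  fun_prop

theorem speed_sq (γ : ProfileCurve) (t : ℝ) :
    γ.speed t ^ 2 = deriv γ.radius t ^ 2 + deriv γ.height t ^ 2 :=
  Real.sq_sqrt (by positivity)

theorem speed_pos (γ : ProfileCurve) (t : ℝ) : 0 < γ.speed t := by
  refine Real.sqrt_pos.2 ?_
  rcases γ.regular t with h | h <;> positivity

theorem hasDerivAt_arcLength (γ : ProfileCurve) (t : ℝ) :
    HasDerivAt γ.arcLength (γ.speed t) t :=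
  γ.continuous_speed.integral_hasStrictDerivAt 0 t |>.hasDerivAt

theorem continuous_arcLength (γ : ProfileCurve) : Continuous γ.arcLength :=
  continuous_iff_continuousAt.2 fun t => (γ.hasDerivAt_arcLength t).continuousAt

theorem arcLength_zero (γ : ProfileCurve) : γ.arcLength 0 = 0 :=
  intervalIntegral.integral_same

theorem strictMono_arcLength (γ : ProfileCurve) : StrictMono γ.arcLength :=
  strictMono_of_hasDerivAt_pos γ.hasDerivAt_arcLength γ.speed_pos

theorem arcLength_pos (γ : ProfileCurve) {t : ℝ} (ht : 0 < t) : 0 < γ.arcLength t :=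
  γ.arcLength_zero ▸ γ.strictMono_arcLength ht

theorem speed_parabola (k t : ℝ) : (parabola k).speed t = Real.sqrt (1 + 4 * k ^ 2 * t ^ 2) := by
  have h : HasDerivAt (parabola k).height (k * (2 * t)) t := by
    simpa [parabola] using (hasDerivAt_pow 2 t).const_mul k
  have h' : HasDerivAt (parabola k).radius 1 t := hasDerivAt_id t
  rw [speed, h.deriv, h'.deriv]
  ring_nf

/-- The speed is at least 1. Arclength is therefore bounded below by t for t ≥ 0 and above by t for
t ≤ 0, which yields completeness. -/
theorem monotone_arcLength_parabola_sub (k : ℝ) :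
    Monotone fun t => (parabola k).arcLength t - t := by
  refine monotone_of_hasDerivAt_nonneg
    (fun t => ((parabola k).hasDerivAt_arcLength t).sub (hasDerivAt_id t)) fun t => ?_
  rw [speed_parabola]
  exact sub_nonneg.2 (Real.one_le_sqrt.2 (by nlinarith [sq_nonneg (k * t)]))

theorem isComplete_parabola (k : ℝ) : (parabola k).IsComplete := by
  have hm := monotone_arcLength_parabola_sub k
  have h0 := (parabola k).arcLength_zero
  constructor
  · refine Filter.tendsto_atTop_mono' _ ?_ Filter.tendsto_id
    filter_upwards [Filter.eventually_ge_atTop 0] with t ht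
    have := hm ht
    simp only [h0] at this
    simp only [id]
    linarith
  · refine Filter.tendsto_atBot_mono' _ ?_ Filter.tendsto_id
    filter_upwards [Filter.eventually_le_atBot 0] with t ht
    have := hm ht
    simp only [h0] at this
    simp only [id]
    linarith

theorem surjective_arcLength {γ : ProfileCurve} (h : γ.IsComplete) :
    Function.Surjective γ.arcLength :=
  γ.continuous_arcLength.surjective h.1 h.2

/-- The meridian parameter of the parabola as a function of arclength. -/
def parabolaParam (k : ℝ) : ℝ ≃o ℝ :=
  (StrictMono.orderIsoOfSurjective _ (parabola k).strictMono_arcLength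
    (surjective_arcLength (isComplete_parabola k))).symm

theorem arcLength_parabolaParam (k s : ℝ) : (parabola k).arcLength (parabolaParam k s) = s :=
  (StrictMono.orderIsoOfSurjective _ (parabola k).strictMono_arcLength
    (surjective_arcLength (isComplete_parabola k))).apply_symm_apply s

theorem parabolaParam_zero (k : ℝ) : parabolaParam k 0 = 0 :=
  (parabola k).strictMono_arcLength.injective <| by
    rw [arcLength_parabolaParam, arcLength_zero]

theorem hasDerivAt_parabolaParam (k s : ℝ) :
    HasDerivAt (parabolaParam k) (Real.sqrt (1 + 4 * k ^ 2 * parabolaParam k s ^ 2))⁻¹ s := by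
  rw [← speed_parabola]
  exact HasDerivAt.of_local_left_inverse (parabolaParam k).continuous.continuousAt
    ((parabola k).hasDerivAt_arcLength _) ((parabola k).speed_pos _).ne'
    (Filter.Eventually.of_forall (arcLength_parabolaParam k))

end ProfileCurve

/-! ### Computing partial derivatives and the Gauss curvature in coordinates -/

theorem pd_eq {i : Fin 2} {X : E2 → E3} {u : E2} {w : E3}
    (h : ∀ j, HasDerivAt (fun t : ℝ => X (u + t • EuclideanSpace.single i 1) j) (w j) 0) :
    pd i X u = w := by
  have h' : HasDerivAt (fun t : ℝ => X (u + t • EuclideanSpace.single i 1)) w 0 := by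
    have := ((PiLp.continuousLinearEquiv 2 ℝ fun _ : Fin 3 => ℝ).symm :
      (Fin 3 → ℝ) →L[ℝ] E3).hasFDerivAt.comp_hasDerivAt (0 : ℝ) (hasDerivAt_pi.2 h)
    exact this
  exact HasLineDerivAt.lineDeriv h'

theorem pd_congr {i : Fin 2} {X Y : E2 → E3} {u : E2} (h : X =ᶠ[𝓝 u] Y) :
    pd i X u = pd i Y u :=
  h.lineDeriv_eq

theorem pd_eq_fderiv {X : E2 → E3} (hX : Differentiable ℝ X) (i : Fin 2) :
    pd i X = fun u => fderiv ℝ X u (EuclideanSpace.single i 1) :=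
  funext fun u => (hX u).lineDeriv_eq_fderiv

theorem contDiff_pd {X : E2 → E3} (hX : ContDiff ℝ ∞ X) (i : Fin 2) : ContDiff ℝ ∞ (pd i X) := by
  rw [pd_eq_fderiv (hX.differentiable (by simp))]
  exact (hX.fderiv_right (m := ∞) (by simp)).clm_apply contDiff_const

theorem isRegularAt_iff {X : E2 → E3} {u : E2} : IsRegularAt X u ↔ normalVec X u ≠ 0 := by
  have h : normalVec X u ≠ 0 ↔ crossProduct (pd 0 X u).ofLp (pd 1 X u).ofLp ≠ 0 := by
    rw [normalVec, Ne, WithLp.toLp_eq_zero]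
  rw [h, crossProduct_ne_zero_iff_linearIndependent, IsRegularAt]
  rw [← LinearMap.linearIndependent_iff (WithLp.linearEquiv 2 ℝ (Fin 3 → ℝ)).toLinearMap
    (LinearEquiv.ker _)]
  have e : (WithLp.linearEquiv 2 ℝ (Fin 3 → ℝ)).toLinearMap ∘ ![pd 0 X u, pd 1 X u] =
      ![(pd 0 X u).ofLp, (pd 1 X u).ofLp] := by
    funext i
    fin_cases i <;> rfl
  rw [e]

/-- Lagrange's identity for the cross product, checked in coordinates. -/
theorem det_firstForm (X : E2 → E3) (u : E2) : (firstForm X u).det = ‖normalVec X u‖ ^ 2 := by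
  rw [EuclideanSpace.real_norm_sq_eq]
  simp [firstForm, normalVec, Matrix.det_fin_two, Fin.sum_univ_three, crossProduct,
    PiLp.inner_apply]
  ring

/-- Needed at the vertex, where the profile formula degenerates: a strict curvature inequality there
spreads to nearby points. -/
theorem continuousAt_gaussCurvature {X : E2 → E3} (hX : ContDiff ℝ ∞ X) {u : E2}
    (hu : IsRegularAt X u) : ContinuousAt (gaussCurvature X) u := by
  have h1 : ∀ i, Continuous (pd i X) := fun i => (contDiff_pd hX i).continuous
  have h2 : ∀ i j, Continuous (pd i (pd j X)) := fun i j =>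
    (contDiff_pd (contDiff_pd hX j) i).continuous
  have hN : Continuous (normalVec X) := by
    unfold normalVec
    refine (PiLp.continuous_toLp 2 _).comp (continuous_pi fun i => ?_)
    have h0 := h1 0
    have h1 := h1 1
    fin_cases i <;> simp [crossProduct] <;> fun_prop
  have hu' := isRegularAt_iff.1 hu
  have hn : ContinuousAt (unitNormal X) u := by
    unfold unitNormal
    exact (hN.norm.continuousAt.inv₀ (norm_ne_zero_iff.2 hu')).smul hN.continuousAt
  have h2' : ∀ i j, ContinuousAt (fun u => inner ℝ (pd i (pd j X) u) (unitNormal X u)) u :=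
    fun i j => (h2 i j).continuousAt.inner hn
  unfold gaussCurvature
  refine ContinuousAt.div ?_ ?_ ?_
  · simp only [secondForm, Matrix.det_fin_two, Matrix.of_apply]
    exact ((h2' 0 0).mul (h2' 1 1)).sub ((h2' 0 1).mul (h2' 1 0))
  · simp only [det_firstForm]
    exact (hN.norm.pow 2).continuousAt
  · rw [det_firstForm]
    exact pow_ne_zero _ (norm_ne_zero_iff.2 hu')

/-- The Gauss curvature in terms of the unnormalized normal vector. -/
theorem gaussCurvature_eq (X : E2 → E3) (u : E2) :
    gaussCurvature X u =
      (inner ℝ (pd 0 (pd 0 X) u) (normalVec X u) * inner ℝ (pd 1 (pd 1 X) u) (normalVec X u) -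
        inner ℝ (pd 0 (pd 1 X) u) (normalVec X u) * inner ℝ (pd 1 (pd 0 X) u) (normalVec X u)) /
      (‖normalVec X u‖ ^ 2) ^ 2 := by
  rw [gaussCurvature, det_firstForm]
  simp only [secondForm, Matrix.det_fin_two, Matrix.of_apply, unitNormal, inner_smul_right]
  -- At a singular point both sides are 0, by the convention for division by zero.
  by_cases h : ‖normalVec X u‖ = 0
  · simp [h]
  · field_simp

/-! ### Rotation of `(A(q) x, A(q) y, B(q))`, `q = x² + y²` -/

/-- The rotationally symmetric map `(x, y) ↦ (A(q) x, A(q) y, B(q))`, where `q = x² + y²`. -/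
def radialMap (A B : ℝ → ℝ) (v : E2) : E3 :=
  !₂[A (v 0 ^ 2 + v 1 ^ 2) * v 0, A (v 0 ^ 2 + v 1 ^ 2) * v 1, B (v 0 ^ 2 + v 1 ^ 2)]

section radial

variable {A B A' B' A'' B'' : ℝ → ℝ}

theorem hasDerivAt_line_zero {f : ℝ → ℝ} {f' : ℝ} {x y : ℝ} (h : HasDerivAt f f' (x ^ 2 + y ^ 2)) :
    HasDerivAt (fun t => f ((x + t) ^ 2 + y ^ 2)) (f' * (2 * x)) 0 := by
  have h1 : HasDerivAt (fun t : ℝ => (x + t) ^ 2 + y ^ 2) (2 * x) 0 := by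
    simpa using (((hasDerivAt_id (0 : ℝ)).const_add x).pow 2).add_const (y ^ 2)
  refine HasDerivAt.comp (0 : ℝ) ?_ h1
  simpa using h

theorem hasDerivAt_line_one {f : ℝ → ℝ} {f' : ℝ} {x y : ℝ} (h : HasDerivAt f f' (x ^ 2 + y ^ 2)) :
    HasDerivAt (fun t => f (x ^ 2 + (y + t) ^ 2)) (f' * (2 * y)) 0 := by
  simp only [add_comm (x ^ 2)] at h ⊢
  exact hasDerivAt_line_zero h

theorem hasDerivAt_shift (x : ℝ) : HasDerivAt (fun t => x + t) 1 0 :=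
  (hasDerivAt_id (0 : ℝ)).const_add x

theorem pd_zero_radialMap {v : E2} (hA : HasDerivAt A (A' (v 0 ^ 2 + v 1 ^ 2)) (v 0 ^ 2 + v 1 ^ 2))
    (hB : HasDerivAt B (B' (v 0 ^ 2 + v 1 ^ 2)) (v 0 ^ 2 + v 1 ^ 2)) :
    pd 0 (radialMap A B) v =
      !₂[2 * A' (v 0 ^ 2 + v 1 ^ 2) * v 0 ^ 2 + A (v 0 ^ 2 + v 1 ^ 2),
        2 * A' (v 0 ^ 2 + v 1 ^ 2) * v 0 * v 1, 2 * B' (v 0 ^ 2 + v 1 ^ 2) * v 0] := by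
  have ha := hasDerivAt_line_zero hA
  have hb := hasDerivAt_line_zero hB
  refine pd_eq fun j => ?_
  fin_cases j <;> simp [radialMap]
  · refine (ha.mul (hasDerivAt_shift (v 0))).congr_deriv ?_
    simp; ring
  · refine (ha.mul_const (v 1)).congr_deriv ?_
    ring
  · refine hb.congr_deriv ?_
    ring

theorem pd_one_radialMap {v : E2} (hA : HasDerivAt A (A' (v 0 ^ 2 + v 1 ^ 2)) (v 0 ^ 2 + v 1 ^ 2))
    (hB : HasDerivAt B (B' (v 0 ^ 2 + v 1 ^ 2)) (v 0 ^ 2 + v 1 ^ 2)) :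
    pd 1 (radialMap A B) v =
      !₂[2 * A' (v 0 ^ 2 + v 1 ^ 2) * v 0 * v 1,
        2 * A' (v 0 ^ 2 + v 1 ^ 2) * v 1 ^ 2 + A (v 0 ^ 2 + v 1 ^ 2),
        2 * B' (v 0 ^ 2 + v 1 ^ 2) * v 1] := by
  have ha := hasDerivAt_line_one hA
  have hb := hasDerivAt_line_one hB
  refine pd_eq fun j => ?_
  fin_cases j <;> simp [radialMap]
  · refine (ha.mul_const (v 0)).congr_deriv ?_
    ring
  · refine (ha.mul (hasDerivAt_shift (v 1))).congr_deriv ?_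
    simp; ring
  · refine hb.congr_deriv ?_
    ring

theorem eventually_mem_of_isOpen {U : Set ℝ} (hU : IsOpen U) {v : E2}
    (hv : v 0 ^ 2 + v 1 ^ 2 ∈ U) : ∀ᶠ w : E2 in 𝓝 v, w 0 ^ 2 + w 1 ^ 2 ∈ U := by
  have : Continuous fun w : E2 => w 0 ^ 2 + w 1 ^ 2 := by fun_prop
  exact this.continuousAt.eventually (hU.mem_nhds hv)

theorem normalVec_radialMap {v : E2}
    (hA : HasDerivAt A (A' (v 0 ^ 2 + v 1 ^ 2)) (v 0 ^ 2 + v 1 ^ 2))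
    (hB : HasDerivAt B (B' (v 0 ^ 2 + v 1 ^ 2)) (v 0 ^ 2 + v 1 ^ 2)) :
    normalVec (radialMap A B) v = A (v 0 ^ 2 + v 1 ^ 2) •
      !₂[-(2 * B' (v 0 ^ 2 + v 1 ^ 2) * v 0), -(2 * B' (v 0 ^ 2 + v 1 ^ 2) * v 1),
        A (v 0 ^ 2 + v 1 ^ 2) + 2 * A' (v 0 ^ 2 + v 1 ^ 2) * (v 0 ^ 2 + v 1 ^ 2)] := by
  rw [normalVec, pd_zero_radialMap hA hB, pd_one_radialMap hA hB]
  ext i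
  fin_cases i <;> simp [crossProduct] <;> ring

theorem norm_normalVec_radialMap_sq {v : E2}
    (hA : HasDerivAt A (A' (v 0 ^ 2 + v 1 ^ 2)) (v 0 ^ 2 + v 1 ^ 2))
    (hB : HasDerivAt B (B' (v 0 ^ 2 + v 1 ^ 2)) (v 0 ^ 2 + v 1 ^ 2)) :
    ‖normalVec (radialMap A B) v‖ ^ 2 = A (v 0 ^ 2 + v 1 ^ 2) ^ 2 *
      (4 * B' (v 0 ^ 2 + v 1 ^ 2) ^ 2 * (v 0 ^ 2 + v 1 ^ 2) +
        (A (v 0 ^ 2 + v 1 ^ 2) + 2 * A' (v 0 ^ 2 + v 1 ^ 2) * (v 0 ^ 2 + v 1 ^ 2)) ^ 2) := by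
  rw [normalVec_radialMap hA hB, EuclideanSpace.real_norm_sq_eq]
  simp [Fin.sum_univ_three]
  ring

theorem gaussCurvature_radialMap {U : Set ℝ} (hU : IsOpen U)
    (hA : ∀ s ∈ U, HasDerivAt A (A' s) s) (hA' : ∀ s ∈ U, HasDerivAt A' (A'' s) s)
    (hB : ∀ s ∈ U, HasDerivAt B (B' s) s) (hB' : ∀ s ∈ U, HasDerivAt B' (B'' s) s)
    {v : E2} {q : ℝ} (hq : v 0 ^ 2 + v 1 ^ 2 = q) (hv : q ∈ U) (hAq : A q ≠ 0) :
    gaussCurvature (radialMap A B) v =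
      2 * B' q * ((A q + 2 * A' q * q) * (4 * B'' q * q + 2 * B' q) -
        2 * B' q * (4 * A'' q * q ^ 2 + 6 * A' q * q)) /
      (A q * (4 * B' q ^ 2 * q + (A q + 2 * A' q * q) ^ 2) ^ 2) := by
  -- As U is open, the formulas for the first partials hold near v and can be differentiated again.
  have hev := eventually_mem_of_isOpen hU (v := v) (by rwa [hq])
  have e0 : pd 0 (radialMap A B) =ᶠ[𝓝 v] _ :=
    hev.mono fun w hw => pd_zero_radialMap (hA _ hw) (hB _ hw)
  have e1 : pd 1 (radialMap A B) =ᶠ[𝓝 v] _ :=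
    hev.mono fun w hw => pd_one_radialMap (hA _ hw) (hB _ hw)
  have hv' : v 0 ^ 2 + v 1 ^ 2 ∈ U := by rwa [hq]
  have a0 := hasDerivAt_line_zero (hA _ hv')
  have a1 := hasDerivAt_line_one (hA _ hv')
  have a0' := hasDerivAt_line_zero (hA' _ hv')
  have a1' := hasDerivAt_line_one (hA' _ hv')
  have b0 := hasDerivAt_line_zero (hB' _ hv')
  have b1 := hasDerivAt_line_one (hB' _ hv')
  rw [hq] at a0 a1 a0' a1' b0 b1
  have s0 := hasDerivAt_shift (v 0)
  have s1 := hasDerivAt_shift (v 1)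
  have p00 : pd 0 (pd 0 (radialMap A B)) v =
      !₂[4 * A'' q * v 0 ^ 3 + 6 * A' q * v 0, 4 * A'' q * v 0 ^ 2 * v 1 + 2 * A' q * v 1,
        4 * B'' q * v 0 ^ 2 + 2 * B' q] := by
    rw [pd_congr e0]
    refine pd_eq fun j => ?_
    fin_cases j <;> simp
    · refine (((a0'.const_mul 2).mul (s0.pow 2)).add a0).congr_deriv ?_
      simp [hq]; ring
    · refine (((a0'.const_mul 2).mul s0).mul_const (v 1)).congr_deriv ?_
      simp [hq]; ring
    · refine ((b0.const_mul 2).mul s0).congr_deriv ?_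
      simp [hq]; ring
  have p10 : pd 1 (pd 0 (radialMap A B)) v =
      !₂[4 * A'' q * v 0 ^ 2 * v 1 + 2 * A' q * v 1, 4 * A'' q * v 0 * v 1 ^ 2 + 2 * A' q * v 0,
        4 * B'' q * v 0 * v 1] := by
    rw [pd_congr e0]
    refine pd_eq fun j => ?_
    fin_cases j <;> simp
    · refine (((a1'.const_mul 2).mul_const (v 0 ^ 2)).add a1).congr_deriv ?_
      ring
    · refine (((a1'.const_mul 2).mul_const (v 0)).mul s1).congr_deriv ?_
      simp [hq]; ring
    · refine ((b1.const_mul 2).mul_const (v 0)).congr_deriv ?_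
      ring
  have p01 : pd 0 (pd 1 (radialMap A B)) v =
      !₂[4 * A'' q * v 0 ^ 2 * v 1 + 2 * A' q * v 1, 4 * A'' q * v 0 * v 1 ^ 2 + 2 * A' q * v 0,
        4 * B'' q * v 0 * v 1] := by
    rw [pd_congr e1]
    refine pd_eq fun j => ?_
    fin_cases j <;> simp
    · refine (((a0'.const_mul 2).mul s0).mul_const (v 1)).congr_deriv ?_
      simp [hq]; ring
    · refine (((a0'.const_mul 2).mul_const (v 1 ^ 2)).add a0).congr_deriv ?_
      ring
    · refine ((b0.const_mul 2).mul_const (v 1)).congr_deriv ?_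
      ring
  have p11 : pd 1 (pd 1 (radialMap A B)) v =
      !₂[4 * A'' q * v 0 * v 1 ^ 2 + 2 * A' q * v 0, 4 * A'' q * v 1 ^ 3 + 6 * A' q * v 1,
        4 * B'' q * v 1 ^ 2 + 2 * B' q] := by
    rw [pd_congr e1]
    refine pd_eq fun j => ?_
    fin_cases j <;> simp
    · refine (((a1'.const_mul 2).mul_const (v 0)).mul s1).congr_deriv ?_
      simp [hq]; ring
    · refine (((a1'.const_mul 2).mul (s1.pow 2)).add a1).congr_deriv ?_
      simp [hq]; ring
    · refine ((b1.const_mul 2).mul s1).congr_deriv ?_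
      simp [hq]; ring
  rw [gaussCurvature_eq, norm_normalVec_radialMap_sq (hA _ hv') (hB _ hv'),
    normalVec_radialMap (hA _ hv') (hB _ hv'), p00, p10, p01, p11]
  simp only [hq, inner_smul_right]
  -- The normal vector carries a factor A q. Restoring the cancelled A q ^ 3 equalizes the
  -- denominators and leaves a polynomial identity.
  rw [show A q * (4 * B' q ^ 2 * q + (A q + 2 * A' q * q) ^ 2) ^ 2 =
    (A q ^ 2 * (4 * B' q ^ 2 * q + (A q + 2 * A' q * q) ^ 2)) ^ 2 / A q ^ 3 by field_simp,
    div_div_eq_mul_div]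
  congr 1
  simp [PiLp.inner_apply, Fin.sum_univ_three]
  rw [← hq]
  ring

end radial

/-! ### Curvature in terms of the profile curve -/

namespace ProfileCurve

/-- The Gauss curvature of a surface of revolution in terms of its profile curve. -/
def meridianCurvature (γ : ProfileCurve) (t : ℝ) : ℝ :=
  deriv γ.height t *
      (deriv γ.radius t * deriv (deriv γ.height) t - deriv γ.height t * deriv (deriv γ.radius) t) /
    (γ.radius t * (γ.speed t ^ 2) ^ 2)

section derivatives

variable (γ : ProfileCurve) (t : ℝ)

theorem hasDerivAt_radius : HasDerivAt γ.radius (deriv γ.radius t) t :=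
  (γ.smooth_radius.differentiable (by simp) t).hasDerivAt

theorem hasDerivAt_height : HasDerivAt γ.height (deriv γ.height t) t :=
  (γ.smooth_height.differentiable (by simp) t).hasDerivAt

theorem hasDerivAt_deriv_radius : HasDerivAt (deriv γ.radius) (deriv (deriv γ.radius) t) t :=
  ((contDiff_infty_iff_deriv.1 γ.smooth_radius).2.differentiable (by simp) t).hasDerivAt

theorem hasDerivAt_deriv_height : HasDerivAt (deriv γ.height) (deriv (deriv γ.height) t) t :=
  ((contDiff_infty_iff_deriv.1 γ.smooth_height).2.differentiable (by simp) t).hasDerivAt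

end derivatives

/-! ### Surfaces with a vertex -/

theorem norm_sq_eq (v : E2) : v 0 ^ 2 + v 1 ^ 2 = ‖v‖ ^ 2 := by
  rw [EuclideanSpace.real_norm_sq_eq, Fin.sum_univ_two]

/-- Writing the map through q = ‖v‖² makes the Cartesian derivative formulas available for q > 0. At
the vertex both sides agree because 0 / 0 = 0. -/
theorem planeMap_eq_radialMap (γ : ProfileCurve) :
    γ.planeMap = radialMap (fun s => γ.radius (√s) / √s) fun s => γ.height (√s) := by
  funext v
  simp only [planeMap, radialMap, norm_sq_eq, Real.sqrt_sq (norm_nonneg v)]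
  congr 1
  ring_nf

theorem hasDerivAt_comp_sqrt {f : ℝ → ℝ} {f' s : ℝ} (hs : 0 < s) (h : HasDerivAt f f' (√s)) :
    HasDerivAt (fun s => f (√s)) (f' / (2 * √s)) s := by
  refine (h.comp s (Real.hasDerivAt_sqrt hs.ne')).congr_deriv ?_
  ring

section planeMap

variable (γ : ProfileCurve)

/-- Derivative of `s ↦ radius √s / √s`. -/
def radialFactorDeriv (s : ℝ) : ℝ :=
  (deriv γ.radius (√s) * √s - γ.radius (√s)) / (2 * √s ^ 3)

/-- Second derivative of `s ↦ radius √s / √s`. -/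
def radialFactorDeriv₂ (s : ℝ) : ℝ :=
  (deriv (deriv γ.radius) (√s) * √s ^ 2 - 3 * (deriv γ.radius (√s) * √s - γ.radius (√s))) /
    (4 * √s ^ 5)

theorem hasDerivAt_radialFactor {s : ℝ} (hs : 0 < s) :
    HasDerivAt (fun s => γ.radius (√s) / √s) (γ.radialFactorDeriv s) s := by
  have hp : √s ≠ 0 := (Real.sqrt_pos.2 hs).ne'
  refine (hasDerivAt_comp_sqrt (f := fun n => γ.radius n / n) hs
    ((γ.hasDerivAt_radius _).div (hasDerivAt_id' _) hp)).congr_deriv ?_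
  rw [radialFactorDeriv]
  field_simp

theorem hasDerivAt_radialFactorDeriv {s : ℝ} (hs : 0 < s) :
    HasDerivAt γ.radialFactorDeriv (γ.radialFactorDeriv₂ s) s := by
  have hp : √s ≠ 0 := (Real.sqrt_pos.2 hs).ne'
  refine (hasDerivAt_comp_sqrt (f := fun n => (deriv γ.radius n * n - γ.radius n) / (2 * n ^ 3)) hs
    ((((γ.hasDerivAt_deriv_radius _).mul (hasDerivAt_id' _)).sub (γ.hasDerivAt_radius _)).div
      ((hasDerivAt_pow 3 _).const_mul 2) (by positivity))).congr_deriv ?_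
  rw [radialFactorDeriv₂]
  field_simp
  simp
  ring

theorem hasDerivAt_height_sqrt {s : ℝ} (hs : 0 < s) :
    HasDerivAt (fun s => γ.height (√s)) (deriv γ.height (√s) / (2 * √s)) s :=
  hasDerivAt_comp_sqrt hs (γ.hasDerivAt_height _)

theorem hasDerivAt_height_sqrt₂ {s : ℝ} (hs : 0 < s) :
    HasDerivAt (fun s => deriv γ.height (√s) / (2 * √s))
      ((deriv (deriv γ.height) (√s) * √s - deriv γ.height (√s)) / (4 * √s ^ 3)) s := by
  have hp : √s ≠ 0 := (Real.sqrt_pos.2 hs).ne'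
  refine (hasDerivAt_comp_sqrt (f := fun n => deriv γ.height n / (2 * n)) hs
    ((γ.hasDerivAt_deriv_height _).div
      ((hasDerivAt_id' _).const_mul 2) (by positivity))).congr_deriv ?_
  field_simp
  ring

theorem isRegularAt_planeMap {v : E2} (hv : v ≠ 0) (hr : γ.radius ‖v‖ ≠ 0) :
    IsRegularAt γ.planeMap v := by
  have hn : 0 < ‖v‖ := norm_pos_iff.2 hv
  have hs : 0 < v 0 ^ 2 + v 1 ^ 2 := by rw [norm_sq_eq]; positivity
  rw [isRegularAt_iff, ← norm_ne_zero_iff, ← pow_ne_zero_iff two_ne_zero, planeMap_eq_radialMap,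
    norm_normalVec_radialMap_sq (A' := γ.radialFactorDeriv)
      (B' := fun s => deriv γ.height (√s) / (2 * √s)) (γ.hasDerivAt_radialFactor hs)
      (γ.hasDerivAt_height_sqrt hs)]
  simp only [radialFactorDeriv, norm_sq_eq, Real.sqrt_sq hn.le]
  have := γ.speed_sq ‖v‖
  have hsp := γ.speed_pos ‖v‖
  -- With q = ‖v‖², the term 4 B'² q is the square of the derivative of the height, and A + 2 A' q
  -- is the derivative of the radius.
  have e : (4 * (deriv γ.height ‖v‖ / (2 * ‖v‖)) ^ 2 * ‖v‖ ^ 2 +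
      (γ.radius ‖v‖ / ‖v‖ + 2 * ((deriv γ.radius ‖v‖ * ‖v‖ - γ.radius ‖v‖) / (2 * ‖v‖ ^ 3)) *
        ‖v‖ ^ 2) ^ 2) = γ.speed ‖v‖ ^ 2 := by
    rw [this]
    field_simp
    ring
  rw [e]
  positivity

theorem gaussCurvature_planeMap {v : E2} (hv : v ≠ 0) (hr : γ.radius ‖v‖ ≠ 0) :
    gaussCurvature γ.planeMap v = γ.meridianCurvature ‖v‖ := by
  have hn : 0 < ‖v‖ := norm_pos_iff.2 hv
  rw [planeMap_eq_radialMap, gaussCurvature_radialMap (U := Set.Ioi 0) isOpen_Ioi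
    (fun s hs => γ.hasDerivAt_radialFactor hs) (fun s hs => γ.hasDerivAt_radialFactorDeriv hs)
    (fun s hs => γ.hasDerivAt_height_sqrt hs) (fun s hs => γ.hasDerivAt_height_sqrt₂ hs)
    (norm_sq_eq v) (Set.mem_Ioi.2 (by positivity))
    (div_ne_zero (by rwa [Real.sqrt_sq hn.le]) (by rw [Real.sqrt_sq hn.le]; exact hn.ne'))]
  simp only [radialFactorDeriv, radialFactorDeriv₂, Real.sqrt_sq hn.le]
  have := γ.speed_sq ‖v‖
  have hsp := γ.speed_pos ‖v‖
  have e : (4 * (deriv γ.height ‖v‖ / (2 * ‖v‖)) ^ 2 * ‖v‖ ^ 2 +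
      (γ.radius ‖v‖ / ‖v‖ + 2 * ((deriv γ.radius ‖v‖ * ‖v‖ - γ.radius ‖v‖) / (2 * ‖v‖ ^ 3)) *
        ‖v‖ ^ 2) ^ 2) = γ.speed ‖v‖ ^ 2 := by
    rw [this]
    field_simp
    ring
  rw [e, meridianCurvature]
  field_simp
  ring

end planeMap

/-- This form has no square roots, so for the paraboloid the radial formulas hold at the vertex as
well. -/
theorem planeMap_parabola_eq_radialMap (k : ℝ) :
    (parabola k).planeMap = radialMap (fun _ => 1) fun s => k * s := by
  funext v
  simp [planeMap_parabola, radialMap]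

theorem isRegularAt_parabola (k : ℝ) (v : E2) : IsRegularAt (parabola k).planeMap v := by
  rw [isRegularAt_iff, ← norm_ne_zero_iff, ← pow_ne_zero_iff two_ne_zero,
    planeMap_parabola_eq_radialMap,
    norm_normalVec_radialMap_sq (A' := fun _ => 0) (B' := fun _ => k) (hasDerivAt_const _ _)
      (by simpa using (hasDerivAt_id (v 0 ^ 2 + v 1 ^ 2)).const_mul k)]
  positivity

/-- The Gauss curvature of the paraboloid at distance `x` from the axis. -/
def paraboloidCurvature (k x : ℝ) : ℝ := 4 * k ^ 2 / (1 + 4 * k ^ 2 * x ^ 2) ^ 2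

theorem paraboloidCurvature_pos {k : ℝ} (hk : 0 < k) (x : ℝ) : 0 < paraboloidCurvature k x := by
  unfold paraboloidCurvature
  positivity

theorem gaussCurvature_parabola (k : ℝ) (v : E2) :
    gaussCurvature (parabola k).planeMap v = paraboloidCurvature k ‖v‖ := by
  rw [planeMap_parabola_eq_radialMap, gaussCurvature_radialMap (U := Set.univ)
    (A' := fun _ => 0) (A'' := fun _ => 0) (B' := fun _ => k) (B'' := fun _ => 0) isOpen_univ
    (fun s _ => hasDerivAt_const _ _) (fun s _ => hasDerivAt_const _ _)
    (fun s _ => by simpa using (hasDerivAt_id s).const_mul k)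
    (fun s _ => hasDerivAt_const _ _) (norm_sq_eq v) trivial one_ne_zero, paraboloidCurvature]
  congr 1 <;> ring

/-! ### Surfaces without vertex -/

section tubeChart

variable (γ : ProfileCurve)

theorem pd_zero_tubeChart : pd 0 γ.tubeChart = fun u =>
    !₂[deriv γ.radius (u 0) * Real.cos (u 1), deriv γ.radius (u 0) * Real.sin (u 1),
      deriv γ.height (u 0)] := by
  funext u
  have hr : HasDerivAt (fun t => γ.radius (u 0 + t)) (deriv γ.radius (u 0)) 0 := by
    simpa using HasDerivAt.comp_const_add (u 0) 0 (by simpa using γ.hasDerivAt_radius (u 0))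
  have hh : HasDerivAt (fun t => γ.height (u 0 + t)) (deriv γ.height (u 0)) 0 := by
    simpa using HasDerivAt.comp_const_add (u 0) 0 (by simpa using γ.hasDerivAt_height (u 0))
  refine pd_eq fun j => ?_
  fin_cases j <;> simp [tubeChart]
  · exact hr.mul_const _
  · exact hr.mul_const _
  · exact hh

theorem hasDerivAt_cos_shift (x : ℝ) :
    HasDerivAt (fun t => Real.cos (x + t)) (-Real.sin x) 0 :=
  HasDerivAt.comp_const_add x 0 (by simpa using Real.hasDerivAt_cos x)

theorem hasDerivAt_sin_shift (x : ℝ) : HasDerivAt (fun t => Real.sin (x + t)) (Real.cos x) 0 :=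
  HasDerivAt.comp_const_add x 0 (by simpa using Real.hasDerivAt_sin x)

theorem pd_one_tubeChart : pd 1 γ.tubeChart = fun u =>
    !₂[-(γ.radius (u 0) * Real.sin (u 1)), γ.radius (u 0) * Real.cos (u 1), 0] := by
  funext u
  have hc := hasDerivAt_cos_shift (u 1)
  have hs := hasDerivAt_sin_shift (u 1)
  refine pd_eq fun j => ?_
  fin_cases j <;> simp [tubeChart]
  · simpa using hc.const_mul (γ.radius (u 0))
  · exact hs.const_mul _
  · exact hasDerivAt_const _ _

theorem normalVec_tubeChart (u : E2) :
    normalVec γ.tubeChart u = γ.radius (u 0) •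
      !₂[-(deriv γ.height (u 0) * Real.cos (u 1)), -(deriv γ.height (u 0) * Real.sin (u 1)),
        deriv γ.radius (u 0)] := by
  rw [normalVec, pd_zero_tubeChart, pd_one_tubeChart]
  have := Real.sin_sq_add_cos_sq (u 1)
  ext i
  fin_cases i <;> simp [crossProduct]
  · ring
  · ring
  · linear_combination deriv γ.radius (u 0) * γ.radius (u 0) * this

theorem norm_normalVec_tubeChart_sq (u : E2) :
    ‖normalVec γ.tubeChart u‖ ^ 2 = γ.radius (u 0) ^ 2 * γ.speed (u 0) ^ 2 := by
  rw [normalVec_tubeChart, EuclideanSpace.real_norm_sq_eq, speed_sq]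
  have := Real.sin_sq_add_cos_sq (u 1)
  simp [Fin.sum_univ_three]
  linear_combination γ.radius (u 0) ^ 2 * deriv γ.height (u 0) ^ 2 * this

theorem isRegularAt_tubeChart {u : E2} (hr : γ.radius (u 0) ≠ 0) : IsRegularAt γ.tubeChart u := by
  rw [isRegularAt_iff, ← norm_ne_zero_iff, ← pow_ne_zero_iff two_ne_zero,
    norm_normalVec_tubeChart_sq]
  have := γ.speed_pos (u 0)
  positivity

theorem gaussCurvature_tubeChart {u : E2} (hr : γ.radius (u 0) ≠ 0) :
    gaussCurvature γ.tubeChart u = γ.meridianCurvature (u 0) := by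
  have hr' : HasDerivAt (fun t => deriv γ.radius (u 0 + t)) (deriv (deriv γ.radius) (u 0)) 0 := by
    simpa using HasDerivAt.comp_const_add (u 0) 0 (by simpa using γ.hasDerivAt_deriv_radius (u 0))
  have hh' : HasDerivAt (fun t => deriv γ.height (u 0 + t)) (deriv (deriv γ.height) (u 0)) 0 := by
    simpa using HasDerivAt.comp_const_add (u 0) 0 (by simpa using γ.hasDerivAt_deriv_height (u 0))
  have hr0 : HasDerivAt (fun t => γ.radius (u 0 + t)) (deriv γ.radius (u 0)) 0 := by
    simpa using HasDerivAt.comp_const_add (u 0) 0 (by simpa using γ.hasDerivAt_radius (u 0))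
  have hc := hasDerivAt_cos_shift (u 1)
  have hs := hasDerivAt_sin_shift (u 1)
  have p00 : pd 0 (pd 0 γ.tubeChart) u = !₂[deriv (deriv γ.radius) (u 0) * Real.cos (u 1),
      deriv (deriv γ.radius) (u 0) * Real.sin (u 1), deriv (deriv γ.height) (u 0)] := by
    rw [pd_zero_tubeChart]
    refine pd_eq fun j => ?_
    fin_cases j <;> simp
    · exact hr'.mul_const _
    · exact hr'.mul_const _
    · exact hh'
  have p10 : pd 1 (pd 0 γ.tubeChart) u = !₂[-(deriv γ.radius (u 0) * Real.sin (u 1)),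
      deriv γ.radius (u 0) * Real.cos (u 1), 0] := by
    rw [pd_zero_tubeChart]
    refine pd_eq fun j => ?_
    fin_cases j <;> simp
    · simpa using hc.const_mul (deriv γ.radius (u 0))
    · exact hs.const_mul _
    · exact hasDerivAt_const _ _
  have p01 : pd 0 (pd 1 γ.tubeChart) u = !₂[-(deriv γ.radius (u 0) * Real.sin (u 1)),
      deriv γ.radius (u 0) * Real.cos (u 1), 0] := by
    rw [pd_one_tubeChart]
    refine pd_eq fun j => ?_
    fin_cases j <;> simp
    · exact (hr0.mul_const _).neg
    · exact hr0.mul_const _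
    · exact hasDerivAt_const _ _
  have p11 : pd 1 (pd 1 γ.tubeChart) u = !₂[-(γ.radius (u 0) * Real.cos (u 1)),
      -(γ.radius (u 0) * Real.sin (u 1)), 0] := by
    rw [pd_one_tubeChart]
    refine pd_eq fun j => ?_
    fin_cases j <;> simp
    · exact (hs.const_mul _).neg
    · simpa using hc.const_mul (γ.radius (u 0))
    · exact hasDerivAt_const _ _
  have hsp := γ.speed_pos (u 0)
  rw [gaussCurvature_eq, norm_normalVec_tubeChart_sq, normalVec_tubeChart, p00, p10, p01, p11,
    meridianCurvature]
  have i00 : inner ℝ (!₂[deriv (deriv γ.radius) (u 0) * Real.cos (u 1),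
      deriv (deriv γ.radius) (u 0) * Real.sin (u 1), deriv (deriv γ.height) (u 0)] : E3)
      !₂[-(deriv γ.height (u 0) * Real.cos (u 1)), -(deriv γ.height (u 0) * Real.sin (u 1)),
        deriv γ.radius (u 0)] = deriv γ.radius (u 0) * deriv (deriv γ.height) (u 0) -
        deriv γ.height (u 0) * deriv (deriv γ.radius) (u 0) := by
    simp [PiLp.inner_apply, Fin.sum_univ_three]
    linear_combination -deriv (deriv γ.radius) (u 0) * deriv γ.height (u 0) *
      Real.sin_sq_add_cos_sq (u 1)
  have i01 : inner ℝ (!₂[-(deriv γ.radius (u 0) * Real.sin (u 1)),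
      deriv γ.radius (u 0) * Real.cos (u 1), 0] : E3)
      !₂[-(deriv γ.height (u 0) * Real.cos (u 1)), -(deriv γ.height (u 0) * Real.sin (u 1)),
        deriv γ.radius (u 0)] = 0 := by
    simp [PiLp.inner_apply, Fin.sum_univ_three]
    ring
  have i11 : inner ℝ (!₂[-(γ.radius (u 0) * Real.cos (u 1)),
      -(γ.radius (u 0) * Real.sin (u 1)), 0] : E3)
      !₂[-(deriv γ.height (u 0) * Real.cos (u 1)), -(deriv γ.height (u 0) * Real.sin (u 1)),
        deriv γ.radius (u 0)] = γ.radius (u 0) * deriv γ.height (u 0) := by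
    simp [PiLp.inner_apply, Fin.sum_univ_three]
    linear_combination γ.radius (u 0) * deriv γ.height (u 0) * Real.sin_sq_add_cos_sq (u 1)
  simp only [inner_smul_right, i00, i01, i11]
  field_simp
  ring

end tubeChart

/-- The Jacobi equation along the meridians: the derivative of the radius with respect to
arclength changes at the rate `-K * radius`. -/
theorem hasDerivAt_radius_arcLength (γ : ProfileCurve) {t : ℝ} (hr : γ.radius t ≠ 0) :
    HasDerivAt (fun t => deriv γ.radius t / γ.speed t)
      (-(γ.speed t * γ.meridianCurvature t * γ.radius t)) t := by
  have hsp := γ.speed_pos t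
  have hsq := γ.speed_sq t
  have h1 := γ.hasDerivAt_deriv_radius t
  have h2 := γ.hasDerivAt_deriv_height t
  have hv : HasDerivAt γ.speed ((deriv γ.radius t * deriv (deriv γ.radius) t +
      deriv γ.height t * deriv (deriv γ.height) t) / γ.speed t) t := by
    refine (((h1.pow 2).add (h2.pow 2)).sqrt ?_).congr_deriv ?_
    · change deriv γ.radius t ^ 2 + deriv γ.height t ^ 2 ≠ 0
      rw [← hsq]
      positivity
    · change _ / (2 * γ.speed t) = _
      field_simp
      simp
      ring
  -- Writing ρ, h, v for radius, height and speed, the quotient rule gives the numerator v²ρ'' -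
  -- ρ'(ρ'ρ'' + h'h''), and v² = ρ'² + h'² reduces it to -h'(ρ'h'' - h'ρ'').
  refine (h1.div hv hsp.ne').congr_deriv ?_
  rw [meridianCurvature]
  field_simp
  rw [hsq]
  ring

end ProfileCurve

/-- By the intermediate value theorem. The factor ε replaces the signed radius by a positive
solution of the same linear equation, so both signs are treated at once. -/
theorem pos_or_neg_of_ne_zero {f : ℝ → ℝ} {s : Set ℝ} (hs : IsPreconnected s)
    (hf : ContinuousOn f s) (h : ∀ t ∈ s, f t ≠ 0) :
    ∃ ε : ℝ, ∀ t ∈ s, 0 < ε * f t := by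
  by_cases hp : ∀ t ∈ s, 0 < f t
  · exact ⟨1, by simpa using hp⟩
  · push Not at hp
    obtain ⟨a, ha, hfa⟩ := hp
    refine ⟨-1, fun t ht => ?_⟩
    by_contra! hft
    obtain ⟨c, hc, hc0⟩ := hs.intermediate_value ha ht hf
      (show (0 : ℝ) ∈ Set.Icc (f a) (f t) from ⟨hfa, by linarith⟩)
    exact h c hc hc0

/-! ### Sturm comparison and concavity along the meridian -/

namespace ProfileCurve

variable {γ : ProfileCurve} {k : ℝ}

theorem continuous_deriv_radius_div_speed (γ : ProfileCurve) :
    Continuous fun t => deriv γ.radius t / γ.speed t :=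
  (γ.smooth_radius.continuous_deriv (by simp)).div γ.continuous_speed fun t => (γ.speed_pos t).ne'

/-- The distance to the axis of the point of the parabola whose arclength is that of `γ` at `t`. -/
def comparisonRadius (γ : ProfileCurve) (k t : ℝ) : ℝ := parabolaParam k (γ.arcLength t)

theorem comparisonRadius_zero (γ : ProfileCurve) (k : ℝ) : γ.comparisonRadius k 0 = 0 := by
  rw [comparisonRadius, arcLength_zero, parabolaParam_zero]

theorem comparisonRadius_pos (γ : ProfileCurve) (k : ℝ) {t : ℝ} (ht : 0 < t) :
    0 < γ.comparisonRadius k t := by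
  have := (parabolaParam k).strictMono (γ.arcLength_pos ht)
  rwa [parabolaParam_zero] at this

theorem tendsto_comparisonRadius (hγ : γ.IsComplete) (k : ℝ) :
    Tendsto (γ.comparisonRadius k) atTop atTop :=
  (parabolaParam k).tendsto_atTop.comp hγ.1

/-- The cosine of the slope angle of the parabola `z = k x²` at `x`. -/
def parabolaSlope (k x : ℝ) : ℝ := (√(1 + 4 * k ^ 2 * x ^ 2))⁻¹

theorem hasDerivAt_parabolaSlope (k x : ℝ) :
    HasDerivAt (parabolaSlope k)
      (-(4 * k ^ 2 * x) / ((1 + 4 * k ^ 2 * x ^ 2) * √(1 + 4 * k ^ 2 * x ^ 2))) x := by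
  have hp : 0 < 1 + 4 * k ^ 2 * x ^ 2 := by positivity
  have hs := Real.sqrt_pos.2 hp
  refine (((((hasDerivAt_pow 2 x).const_mul (4 * k ^ 2)).const_add 1).sqrt hp.ne').inv
    hs.ne').congr_deriv ?_
  rw [Real.sq_sqrt hp.le]
  field_simp
  simp

theorem hasDerivAt_comparisonRadius (γ : ProfileCurve) (k t : ℝ) :
    HasDerivAt (γ.comparisonRadius k) (γ.speed t * parabolaSlope k (γ.comparisonRadius k t)) t := by
  refine ((hasDerivAt_parabolaParam k _).comp t (γ.hasDerivAt_arcLength t)).congr_deriv ?_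
  rw [mul_comm]
  rfl

theorem hasDerivAt_comparisonSlope (γ : ProfileCurve) (k t : ℝ) :
    HasDerivAt (fun t => parabolaSlope k (γ.comparisonRadius k t))
      (-(γ.speed t * paraboloidCurvature k (γ.comparisonRadius k t) *
        γ.comparisonRadius k t)) t := by
  refine ((hasDerivAt_parabolaSlope k _).comp t
    (γ.hasDerivAt_comparisonRadius k t)).congr_deriv ?_
  rw [paraboloidCurvature, parabolaSlope]
  generalize γ.comparisonRadius k t = x
  have hp : 0 < 1 + 4 * k ^ 2 * x ^ 2 := by positivity
  have hs := Real.sqrt_pos.2 hp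
  have := Real.sq_sqrt hp.le
  field_simp
  rw [this]

/-- Since the slope is the arclength derivative of the radius x, this bounds the growth of x² by a
linear function of arclength. It is the source of the divergence of ∫ ds / x². -/
theorem two_mul_parabolaSlope_le (k x : ℝ) : 2 * k * x * parabolaSlope k x ≤ 1 := by
  have hp : 0 < 1 + 4 * k ^ 2 * x ^ 2 := by positivity
  rw [parabolaSlope, ← div_eq_mul_inv, div_le_one (Real.sqrt_pos.2 hp)]
  exact Real.le_sqrt_of_sq_le (by nlinarith)

/-- Sturm comparison with the paraboloid: as `∫ ds / x² = ∞` along the parabola, a meridian that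
starts on the axis and is more curved than the parabola returns to the axis. -/
theorem exists_radius_eq_zero (hk : 0 < k) (hγ : γ.IsComplete) (h0 : γ.radius 0 = 0)
    (hK : ∀ t, 0 < t → γ.radius t ≠ 0 →
      paraboloidCurvature k (γ.comparisonRadius k t) ≤ γ.meridianCurvature t)
    (hlt : ∃ t, 0 < t ∧
      paraboloidCurvature k (γ.comparisonRadius k t) < γ.meridianCurvature t) :
    ∃ t, 0 < t ∧ γ.radius t = 0 := by
  by_contra! hr
  obtain ⟨ε, hε⟩ := pos_or_neg_of_ne_zero isPreconnected_Ioi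
    γ.smooth_radius.continuous.continuousOn hr
  obtain ⟨t₀, ht₀, hlt⟩ := hlt
  set Q := γ.comparisonRadius k with hQ
  set q := fun t => parabolaSlope k (Q t) with hq
  set r := fun t => ε * γ.radius t with hr_def
  set a := fun t => ε * (deriv γ.radius t / γ.speed t) with ha_def
  have dr : ∀ t, HasDerivAt r (γ.speed t * a t) t := fun t =>
    ((γ.hasDerivAt_radius t).const_mul ε).congr_deriv (by
      have := (γ.speed_pos t).ne'
      simp only [ha_def]
      field_simp)
  have da : ∀ t, 0 < t → HasDerivAt a (-(γ.speed t * γ.meridianCurvature t * r t)) t := fun t ht =>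
    ((γ.hasDerivAt_radius_arcLength (hr t ht)).const_mul ε).congr_deriv (by
      simp only [hr_def]
      ring)
  have dQ : ∀ t, HasDerivAt Q (γ.speed t * q t) t := γ.hasDerivAt_comparisonRadius k
  have dq : ∀ t, HasDerivAt q (-(γ.speed t * paraboloidCurvature k (Q t) * Q t)) t :=
    γ.hasDerivAt_comparisonSlope k
  have Qpos : ∀ t, 0 < t → 0 < Q t := fun t => γ.comparisonRadius_pos k
  -- The Wronskian of the two Jacobi solutions r and Q, with a and q their derivatives in arclength.
  set w := fun t => a t * Q t - r t * q t with hw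
  have dw : ∀ t, 0 < t → HasDerivAt w (γ.speed t * (r t * Q t) *
      (paraboloidCurvature k (Q t) - γ.meridianCurvature t)) t := fun t ht =>
    (((da t ht).mul (dQ t)).sub ((dr t).mul (dq t))).congr_deriv (by ring)
  have w0 : w 0 = 0 := by simp [hw, hr_def, hQ, h0, comparisonRadius_zero]
  have wanti : AntitoneOn w (Set.Ici 0) := by
    -- The Jacobi equation for r is available only for t > 0, where the radius is nonzero;
    -- continuity extends monotonicity to 0.
    refine antitoneOn_of_hasDerivWithinAt_nonpos (convex_Ici 0) ?_
      (fun t ht => (dw t (by simpa using ht)).hasDerivWithinAt) fun t ht => ?_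
    · have hac : Continuous a := γ.continuous_deriv_radius_div_speed.const_mul ε
      have hrc : Continuous r := continuous_iff_continuousAt.2 fun t => (dr t).continuousAt
      have hQc : Continuous Q := continuous_iff_continuousAt.2 fun t => (dQ t).continuousAt
      have hqc : Continuous q := continuous_iff_continuousAt.2 fun t => (dq t).continuousAt
      exact ((hac.mul hQc).sub (hrc.mul hqc)).continuousOn
    · rw [interior_Ici] at ht
      have := γ.speed_pos t
      have := Qpos t ht
      have := hε t ht
      exact mul_nonpos_of_nonneg_of_nonpos (by positivity) (sub_nonpos.2 (hK t ht (hr t ht)))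
  have w1 : w (t₀ + 1) < 0 := by
    by_contra! h
    -- Otherwise w, antitone from w 0 = 0, would vanish around t₀, against its strictly negative
    -- derivative at t₀.
    have hconst : w =ᶠ[𝓝 t₀] fun _ => 0 := by
      filter_upwards [Ioo_mem_nhds ht₀ (lt_add_one t₀)] with t ht
      refine le_antisymm ?_ (h.trans ?_)
      · rw [← w0]
        exact wanti (Set.mem_Ici.2 le_rfl) (Set.mem_Ici.2 ht.1.le) ht.1.le
      · exact wanti (Set.mem_Ici.2 ht.1.le) (Set.mem_Ici.2 (by linarith)) ht.2.le
    have := (dw t₀ ht₀).unique ((hasDerivAt_const t₀ (0 : ℝ)).congr_of_eventuallyEq hconst)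
    have h1 := γ.speed_pos t₀
    have h2 := Qpos t₀ ht₀
    have h3 := hε t₀ ht₀
    have h4 : 0 < γ.speed t₀ * (r t₀ * Q t₀) := by positivity
    nlinarith
  set t₁ := t₀ + 1
  have ht₁ : 0 < t₁ := by positivity
  -- The logarithm stands in for -w t₁ times ∫ ds / Q²: past t₁ one has w ≤ w t₁ ≤ w t₁ * (2kQq), as
  -- w t₁ < 0 and 2kQq ≤ 1, so g decreases.
  set g := fun t => r t / Q t + 2 * k * (-w t₁) * Real.log (Q t) with hg
  have dg : ∀ t, 0 < t → HasDerivAt g (γ.speed t / Q t ^ 2 *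
      (w t - w t₁ * (2 * k * Q t * q t))) t := fun t ht => by
    have := (Qpos t ht).ne'
    refine (((dr t).div (dQ t) this).add (((dQ t).log this).const_mul _)).congr_deriv ?_
    simp only [hw]
    field_simp
    ring
  have ganti : AntitoneOn g (Set.Ici t₁) := by
    refine antitoneOn_of_hasDerivWithinAt_nonpos (convex_Ici t₁)
      (fun t ht => (dg t (ht₁.trans_le ht)).continuousAt.continuousWithinAt)
      (fun t ht => (dg t (ht₁.trans (by simpa using ht))).hasDerivWithinAt) fun t ht => ?_
    rw [interior_Ici] at ht
    have ht0 : 0 < t := ht₁.trans ht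
    have h1 := γ.speed_pos t
    have h2 := wanti (Set.mem_Ici.2 ht₁.le) (Set.mem_Ici.2 ht0.le) (le_of_lt ht)
    have h3 : 2 * k * Q t * q t ≤ 1 := two_mul_parabolaSlope_le k (Q t)
    exact mul_nonpos_of_nonneg_of_nonpos (by positivity) (by nlinarith)
  have hc : 0 < 2 * k * (-w t₁) := by nlinarith
  have hlog : Tendsto (fun t => 2 * k * (-w t₁) * Real.log (Q t)) atTop atTop :=
    (Real.tendsto_log_atTop.comp (tendsto_comparisonRadius hγ k)).const_mul_atTop hc
  obtain ⟨t, ht, hgt⟩ := ((eventually_ge_atTop t₁).and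
    (hlog.eventually (eventually_ge_atTop (g t₁)))).exists
  have ht0 : 0 < t := ht₁.trans_le ht
  have h1 := ganti (Set.mem_Ici.2 le_rfl) (Set.mem_Ici.2 ht) ht
  have h2 : 0 < r t / Q t := div_pos (hε t ht0) (Qpos t ht0)
  simp only [hg] at h1 hgt
  linarith

/-- A complete profile curve that avoids the axis generates points of non-positive curvature. -/
theorem exists_meridianCurvature_nonpos (hγ : γ.IsComplete) (hr : ∀ t, γ.radius t ≠ 0) :
    ∃ t, γ.meridianCurvature t ≤ 0 := by
  by_contra! hK
  obtain ⟨ε, hε⟩ := pos_or_neg_of_ne_zero isPreconnected_univ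
    γ.smooth_radius.continuous.continuousOn fun t _ => hr t
  set r := fun t => ε * γ.radius t with hr_def
  set a := fun t => ε * (deriv γ.radius t / γ.speed t) with ha_def
  have dr : ∀ t, HasDerivAt r (γ.speed t * a t) t := fun t =>
    ((γ.hasDerivAt_radius t).const_mul ε).congr_deriv (by
      have := (γ.speed_pos t).ne'
      simp only [ha_def]
      field_simp)
  have da : ∀ t, HasDerivAt a (-(γ.speed t * γ.meridianCurvature t * r t)) t := fun t =>
    ((γ.hasDerivAt_radius_arcLength (hr t)).const_mul ε).congr_deriv (by
      simp only [hr_def]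
      ring)
  have aanti : StrictAnti a := strictAnti_of_hasDerivAt_neg da fun t => by
    have := mul_pos (mul_pos (γ.speed_pos t) (hK t)) (hε t trivial)
    linarith
  have dsub : ∀ c t, HasDerivAt (fun t => r t - c * γ.arcLength t) (γ.speed t * (a t - c)) t :=
    fun c t => ((dr t).sub ((γ.hasDerivAt_arcLength t).const_mul c)).congr_deriv (by ring)
  have dcont : ∀ c, Continuous fun t => r t - c * γ.arcLength t := fun c =>
    continuous_iff_continuousAt.2 fun t => (dsub c t).continuousAt
  -- The positive function r has strictly decreasing arclength derivative a. Where a is negative, r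
  -- falls below a descending line to the right; where it is positive, r falls below such a line to
  -- the left.
  rcases lt_or_ge (a 0) 0 with h | h
  · have hanti : AntitoneOn (fun t => r t - a 0 * γ.arcLength t) (Set.Ici 0) := by
      refine antitoneOn_of_hasDerivWithinAt_nonpos (convex_Ici 0) (dcont _).continuousOn
        (fun t _ => (dsub _ t).hasDerivWithinAt) fun t ht => ?_
      rw [interior_Ici] at ht
      exact mul_nonpos_of_nonneg_of_nonpos (γ.speed_pos t).le (sub_nonpos.2 (aanti ht).le)
    obtain ⟨t, ht, hgt⟩ := ((eventually_ge_atTop 0).and ((hγ.1.const_mul_atTop_of_neg h).eventually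
      (eventually_le_atBot (-r 0)))).exists
    have h1 := hanti (Set.mem_Ici.2 le_rfl) (Set.mem_Ici.2 ht) ht
    have h2 : 0 < r t := hε t trivial
    simp only [arcLength_zero] at h1
    linarith
  -- Since a 0 may be zero, a step back to -1 secures a strictly positive slope.
  · have h' : 0 < a (-1) := h.trans_lt (aanti (by norm_num))
    have hmono : MonotoneOn (fun t => r t - a (-1) * γ.arcLength t) (Set.Iic (-1)) := by
      refine monotoneOn_of_hasDerivWithinAt_nonneg (convex_Iic (-1)) (dcont _).continuousOn
        (fun t _ => (dsub _ t).hasDerivWithinAt) fun t ht => ?_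
      rw [interior_Iic] at ht
      exact mul_nonneg (γ.speed_pos t).le (sub_nonneg.2 (aanti ht).le)
    obtain ⟨t, ht, hgt⟩ := ((eventually_le_atBot (-1)).and
      ((hγ.2.const_mul_atBot h').eventually
        (eventually_le_atBot (-(r (-1) - a (-1) * γ.arcLength (-1)))))).exists
    have h1 := hmono (Set.mem_Iic.2 ht) (Set.mem_Iic.2 le_rfl) ht
    have h2 : 0 < r t := hε t trivial
    simp only at h1
    linarith

/-! ### Embeddedness keeps the meridian off the axis -/

/-- At a zero of the radius the whole parallel collapses to one point of the axis, so opposite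
points of it would coincide. -/
theorem radius_ne_zero_of_injective_planeMap (h : Function.Injective γ.planeMap) {t : ℝ}
    (ht : 0 < t) : γ.radius t ≠ 0 := by
  intro h0
  have e : γ.planeMap (EuclideanSpace.single 0 t) = γ.planeMap (-EuclideanSpace.single 0 t) := by
    simp [planeMap, abs_of_pos ht, h0]
  have := congrArg (fun v : E2 => v 0) (h e)
  simp at this
  linarith

theorem radius_ne_zero_of_injective_tubeMap (h : Function.Injective γ.tubeMap) (t : ℝ) :
    γ.radius t ≠ 0 := by
  intro h0
  have e : γ.tubeMap (t, 1) = γ.tubeMap (t, Circle.exp Real.pi) := by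
    simp [tubeMap, h0]
  have := congrArg (fun z : Circle => (z : ℂ)) (Prod.ext_iff.1 (h e)).2
  simp at this
  norm_num [Complex.ext_iff] at this

/-! ### The paraboloid is most curved -/

theorem norm_single_of_nonneg {t : ℝ} (ht : 0 ≤ t) :
    ‖(EuclideanSpace.single 0 t : E2)‖ = t := by
  simp [abs_of_nonneg ht]

/-- Points at equal distance correspond under `comparisonRadius`, so the hypothesis becomes an
inequality along the meridian, to which the Sturm comparison applies. -/
theorem not_isEmbeddedPlane_of_curvatureExceeds (hk : 0 < k) (hv : γ.HasVertex)
    (hγ : γ.IsComplete) (hex : CurvatureExceeds γ.planeMap γ.vertexDist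
      (parabola k).planeMap (parabola k).vertexDist) : ¬ γ.IsEmbeddedPlane := by
  intro hemb
  have hX : ContDiff ℝ ∞ γ.planeMap := hemb.contMDiff.contDiff
  have hr : ∀ t, 0 < t → γ.radius t ≠ 0 := fun t =>
    radius_ne_zero_of_injective_planeMap hemb.isEmbedding.injective
  have hcurv : ∀ u : E2, u ≠ 0 → gaussCurvature γ.planeMap u = γ.meridianCurvature ‖u‖ :=
    fun u hu => γ.gaussCurvature_planeMap hu (hr _ (norm_pos_iff.2 hu))
  have hdist : ∀ u v : E2, γ.vertexDist u = (parabola k).vertexDist v →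
      ‖v‖ = γ.comparisonRadius k ‖u‖ := fun u v h =>
    (parabola k).strictMono_arcLength.injective <| by
      rw [comparisonRadius, arcLength_parabolaParam]
      exact h.symm
  suffices h : ∃ t, 0 < t ∧ γ.radius t = 0 by
    obtain ⟨t, ht, h0⟩ := h
    exact hr t ht h0
  refine exists_radius_eq_zero hk hγ ?_ (fun t ht _ => ?_) ?_
  · have := hv.1 0
    rw [neg_zero] at this
    linarith
  · have hu := norm_single_of_nonneg ht.le
    have hw := norm_single_of_nonneg (γ.comparisonRadius_pos k ht).le
    have hne : (EuclideanSpace.single 0 t : E2) ≠ 0 := by simpa using ht.ne'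
    have := hex.1 (EuclideanSpace.single 0 t) (EuclideanSpace.single 0 (γ.comparisonRadius k t))
      (γ.isRegularAt_planeMap hne (by rw [hu]; exact hr t ht)) (isRegularAt_parabola k _) (by
        rw [vertexDist, vertexDist, hu, hw, comparisonRadius, arcLength_parabolaParam])
    rwa [gaussCurvature_parabola, hcurv _ hne, hu, hw] at this
  · obtain ⟨u, v, hu, -, hd, hlt⟩ := hex.2
    rw [gaussCurvature_parabola, hdist u v hd] at hlt
    -- If the strict inequality is known only at the vertex, continuity moves it to some small t >
    -- 0, where the profile formula holds.
    by_cases hu0 : u = 0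
    · subst hu0
      have hline : Continuous fun t : ℝ => (EuclideanSpace.single 0 t : E2) :=
        (Isometry.of_dist_eq fun a b => PiLp.dist_single_same 2 (fun _ : Fin 2 => ℝ) 0 a b).continuous
      have hzero : (EuclideanSpace.single 0 0 : E2) = 0 := by simp
      have hc1 : ContinuousAt
          (fun t : ℝ => gaussCurvature γ.planeMap (EuclideanSpace.single 0 t)) 0 := by
        have hc0 : ContinuousAt (gaussCurvature γ.planeMap) (EuclideanSpace.single 0 (0 : ℝ)) := by
          rw [hzero]
          exact continuousAt_gaussCurvature hX hu
        exact ContinuousAt.comp (g := gaussCurvature γ.planeMap) hc0 hline.continuousAt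
      have hc2 : ContinuousAt (fun t => paraboloidCurvature k (γ.comparisonRadius k t)) 0 := by
        have hQ := (γ.hasDerivAt_comparisonRadius k 0).continuousAt
        unfold paraboloidCurvature
        exact continuousAt_const.div
          ((continuousAt_const.add (continuousAt_const.mul (hQ.pow 2))).pow 2) (by positivity)
      have hev := hc2.eventually_lt hc1 (by rw [hzero]; simpa using hlt)
      obtain ⟨t, hlt', ht⟩ := ((hev.filter_mono nhdsWithin_le_nhds).and
        (self_mem_nhdsWithin (s := Set.Ioi (0 : ℝ)))).exists
      have ht : 0 < t := ht
      refine ⟨t, ht, ?_⟩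
      rwa [hcurv _ (by simpa using ht.ne'), norm_single_of_nonneg ht.le] at hlt'
    · rw [hcurv u hu0] at hlt
      exact ⟨‖u‖, norm_pos_iff.2 hu0, hlt⟩

/-- An embedded tube avoids the axis and so has a parallel of non-positive curvature, while every
point of the paraboloid has positive curvature. -/
theorem not_isEmbeddedTube_of_curvatureExceeds (hk : 0 < k)
    (hγ : γ.IsComplete) (hex : CurvatureExceeds γ.tubeChart γ.tubeDist
      (parabola k).planeMap (parabola k).vertexDist) : ¬ γ.IsEmbeddedTube := by
  intro hemb
  have hr := radius_ne_zero_of_injective_tubeMap hemb.isEmbedding.injective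
  obtain ⟨t, ht⟩ := exists_meridianCurvature_nonpos hγ hr
  refine ht.not_gt ?_
  have hpos : 0 ≤ parabolaParam k |γ.arcLength t| := by
    have := (parabolaParam k).monotone (abs_nonneg (γ.arcLength t))
    rwa [parabolaParam_zero] at this
  have hr' : γ.radius ((EuclideanSpace.single 0 t : E2) 0) ≠ 0 := hr _
  have := hex.1 (EuclideanSpace.single 0 t)
    (EuclideanSpace.single 0 (parabolaParam k |γ.arcLength t|))
    (γ.isRegularAt_tubeChart hr') (isRegularAt_parabola k _) (by
      rw [tubeDist, vertexDist, norm_single_of_nonneg hpos, arcLength_parabolaParam]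
      simp)
  rw [gaussCurvature_parabola, γ.gaussCurvature_tubeChart hr'] at this
  refine (paraboloidCurvature_pos hk _).trans_le (this.trans_eq ?_)
  simp

end ProfileCurve

end RevolutionSurface

end

theorem mainTheorem8 (k : ℝ) (hk : 0 < k) :
    ((RevolutionSurface.ProfileCurve.parabola k).HasVertex ∧
      (RevolutionSurface.ProfileCurve.parabola k).IsComplete ∧
      (RevolutionSurface.ProfileCurve.parabola k).IsEmbeddedPlane) ∧
    (∀ γ : RevolutionSurface.ProfileCurve, γ.HasVertex → γ.IsComplete →
      RevolutionSurface.CurvatureExceeds γ.planeMap γ.vertexDist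
        (RevolutionSurface.ProfileCurve.parabola k).planeMap
        (RevolutionSurface.ProfileCurve.parabola k).vertexDist →
      ¬ γ.IsEmbeddedPlane) ∧
    (∀ γ : RevolutionSurface.ProfileCurve, γ.IsComplete →
      RevolutionSurface.CurvatureExceeds γ.tubeChart γ.tubeDist
        (RevolutionSurface.ProfileCurve.parabola k).planeMap
        (RevolutionSurface.ProfileCurve.parabola k).vertexDist →
      ¬ γ.IsEmbeddedTube) :=
  ⟨⟨RevolutionSurface.ProfileCurve.hasVertex_parabola k,
      RevolutionSurface.ProfileCurve.isComplete_parabola k,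
      RevolutionSurface.ProfileCurve.isEmbeddedPlane_parabola k⟩,
    fun _ hv hγ hex =>
      RevolutionSurface.ProfileCurve.not_isEmbeddedPlane_of_curvatureExceeds hk hv hγ hex,
    fun _ hγ hex =>
      RevolutionSurface.ProfileCurve.not_isEmbeddedTube_of_curvatureExceeds hk hγ hex⟩
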